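/- For $\psi>0$ and $\xi\in\mathbb R$ let $G_{\xi,\psi}$ be the distribution function of the generalized Pareto distribution: $G_{\xi,\psi}(x)=0$ for $x\le 0$ and, for $x>0$, $G_{\xi,\psi}(x)=1-\max(0,1+\xi x/\psi)^{-1/\xi}$ if $\xi\ne0$, $G_{0,\psi}(x)=1-e^{-x/\psi}$. For a real random variable $X$ with distribution function $F$ let $x_+=\sup\{x: F(x)<1\}\in(-\infty,\infty]$ and, for $t<x_+$, let $F_t(x)=P(X-t\le x\mid X>t)$ be the distribution function of the residual distribution of $X$ over $t$. Say that the limiting behaviour of the residual distribution of $X$ is GPD with shape $\xi$ if there is a positive function $\psi(t)$ such that $\lim_{t\uparrow x_+}\sup_{x\in\mathbb R}|F_t(x)-G_{\xi,\psi(t)}(x)|=0$. Let $X$ be a real random variable such that the limiting behaviour of its residual distribution is GPD with shape $\xi$. (1) If $\xi\ge 0$ and $X>0$ almost surely, then the limiting behaviour of the residual distribution of $X^*=-1/X$ is GPD with shape $-\xi$. (2) If $\xi<0$, then $x_+<\infty$ and the limiting behaviour of the residual distribution of $X^*=-1/(X-x_+)$ is GPD with shape $-\xi$; in particular, if $x_+=0$,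 this holds for $X^*=-1/X$. -/

import Mathlib

open MeasureTheory ProbabilityTheory Filter Topology Set

noncomputable section

/-- Distribution function of the generalized Pareto distribution with shape `ξ` and scale `ψ > 0`:
`1 - (1 + ξ x / ψ)^(-1/ξ)` on its support, the exponential distribution function for `ξ = 0`.
For `ξ < 0` and `x ≥ ψ / |ξ|` the truncation at `0` makes the value equal to `1`. -/
def gpdCDF (ξ ψ x : ℝ) : ℝ :=
  if x ≤ 0 then 0
  else if ξ = 0 then 1 - Real.exp (-x / ψ)
  else 1 - (max 0 (1 + ξ * x / ψ)) ^ (-1 / ξ)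

/-- The right endpoint `x₊ = sup {x : F x < 1}` of the distribution function `F` of `X`,
possibly `+∞`. -/
def rightEndpoint {Ω : Type*} [MeasurableSpace Ω] (P : Measure Ω) (X : Ω → ℝ) : EReal :=
  sSup ((fun x : ℝ => (x : EReal)) '' {x : ℝ | cdf (P.map X) x < 1})

/-- The residual distribution of `X` over `t`: the law of `X - t` conditionally on `X > t`. -/
def residualLaw {Ω : Type*} [MeasurableSpace Ω] (P : Measure Ω) (X : Ω → ℝ) (t : ℝ) : Measure ℝ :=
  (P[|{ω | t < X ω}]).map (fun ω => X ω - t)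

/-- Real thresholds `t` tending to the right endpoint of `X` from below. -/
def highThresholds {Ω : Type*} [MeasurableSpace Ω] (P : Measure Ω) (X : Ω → ℝ) : Filter ℝ :=
  comap (fun t : ℝ => (t : EReal)) (𝓝[<] rightEndpoint P X)

/-- The limiting behaviour of the residual distribution of `X` over high thresholds is GPD with
shape `ξ`: for some positive scale function `ψ`, the distribution function of the residual
distribution over `t` and that of `GPD(ξ, ψ t)` become uniformly close as `t` tends to the
right endpoint. -/
def ResidualLimitGPD {Ω : Type*} [MeasurableSpace Ω] (P : Measure Ω) (X : Ω → ℝ) (ξ : ℝ) : Prop :=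
  ∃ ψ : ℝ → ℝ, (∀ t, 0 < ψ t) ∧
    TendstoUniformly (fun t x => cdf (residualLaw P X t) x - gpdCDF ξ (ψ t) x) (fun _ => 0)
      (highThresholds P X)

end

/-! Write `S` for the survival function of `X` and `K_ξ` for that of the unit-scale GPD. Two
consecutive steps of the residual limit, over `t` and then over `t + x * ψ t`, compose to a single
one; as `K_ξ (x + (1 + ξ x) z) = K_ξ x * K_ξ z`, this forces `ψ (t + x * ψ t) ~ (1 + ξ x) * ψ t`.
So `ψ` is asymptotically affine with slope `ξ`, and `ψ t / (t - a) → ξ`, where `a` is the right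
endpoint if that is finite and any real number otherwise.

With `ρ = ψ t / (t - a)`, the point `u = t + y / (1 - ρ y) * ψ t` satisfies
`-1 / (u - a) = s + y * s² ψ t` for `s = -1 / (t - a)`. Hence `-1 / (X - a)` has scale `s² ψ t`
over `s` and the limit `K_ξ (y / (1 - ξ y)) = K_{-ξ} y`. Pointwise convergence of these monotone
functions to a continuous one is uniform by Pólya's theorem. -/

/-- The survival function `1 - G_{ξ,1}` of the generalized Pareto distribution with unit scale. -/
noncomputable def gpdSurvival (ξ x : ℝ) : ℝ :=
  if ξ = 0 then Real.exp (-max x 0) else max 0 (1 + ξ * max x 0) ^ (-1 / ξ)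

section GPDSurvival

variable {ξ x y z : ℝ}

theorem gpdCDF_eq_one_sub_gpdSurvival {ψ : ℝ} (hψ : 0 < ψ) (ξ x : ℝ) :
    gpdCDF ξ ψ x = 1 - gpdSurvival ξ (x / ψ) := by
  unfold gpdCDF gpdSurvival
  rcases le_or_gt x 0 with hx | hx
  · have : max (x / ψ) 0 = 0 := max_eq_right (div_nonpos_of_nonpos_of_nonneg hx hψ.le)
    simp [hx, this]
  · have : max (x / ψ) 0 = x / ψ := max_eq_left (by positivity)
    simp only [this, not_le.2 hx, if_false, neg_div, mul_div_assoc]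
    split_ifs <;> rfl

theorem gpdSurvival_zero_left (hx : 0 ≤ x) : gpdSurvival 0 x = Real.exp (-x) := by
  simp [gpdSurvival, hx]

theorem gpdSurvival_of_ne_zero (hξ : ξ ≠ 0) (hx : 0 ≤ x) :
    gpdSurvival ξ x = max 0 (1 + ξ * x) ^ (-1 / ξ) := by
  simp [gpdSurvival, hξ, hx]

theorem gpdSurvival_of_nonpos (ξ : ℝ) (hx : x ≤ 0) : gpdSurvival ξ x = 1 := by
  simp [gpdSurvival, hx]

theorem gpdSurvival_max_zero (ξ x : ℝ) : gpdSurvival ξ (max x 0) = gpdSurvival ξ x := by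
  simp [gpdSurvival]

theorem gpdSurvival_nonneg (ξ x : ℝ) : 0 ≤ gpdSurvival ξ x := by
  unfold gpdSurvival
  split_ifs <;> positivity

theorem gpdSurvival_pos (h : 0 < 1 + ξ * x) : 0 < gpdSurvival ξ x := by
  rcases le_or_gt x 0 with hx | hx
  · simp [gpdSurvival_of_nonpos ξ hx]
  by_cases hξ : ξ = 0
  · rw [hξ, gpdSurvival_zero_left hx.le]
    exact Real.exp_pos _
  · rw [gpdSurvival_of_ne_zero hξ hx.le, max_eq_right h.le]
    exact Real.rpow_pos_of_pos h _

theorem gpdSurvival_eq_zero (hx : 0 ≤ x) (h : 1 + ξ * x ≤ 0) : gpdSurvival ξ x = 0 := by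
  have hξ : ξ ≠ 0 := by
    rintro rfl
    linarith
  rw [gpdSurvival_of_ne_zero hξ hx, max_eq_left h]
  exact Real.zero_rpow (div_ne_zero (by norm_num) hξ)

theorem gpdSurvival_add_mul (hx : 0 ≤ x) (hz : 0 ≤ z) (h : 0 < 1 + ξ * x) :
    gpdSurvival ξ (x + (1 + ξ * x) * z) = gpdSurvival ξ x * gpdSurvival ξ z := by
  have h0 : 0 ≤ x + (1 + ξ * x) * z := by positivity
  by_cases hξ : ξ = 0
  · subst hξ
    rw [gpdSurvival_zero_left hx, gpdSurvival_zero_left hz, gpdSurvival_zero_left h0,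
      ← Real.exp_add]
    ring_nf
  · rw [gpdSurvival_of_ne_zero hξ hx, gpdSurvival_of_ne_zero hξ hz, gpdSurvival_of_ne_zero hξ h0,
      ← Real.mul_rpow (le_max_left _ _) (le_max_left _ _), max_eq_right h.le,
      mul_max_of_nonneg _ _ h.le, mul_zero]
    ring_nf

theorem gpdSurvival_div_one_sub_mul (hx : 0 ≤ x) (h : 0 < 1 - ξ * x) :
    gpdSurvival ξ (x / (1 - ξ * x)) = gpdSurvival (-ξ) x := by
  by_cases hξ : ξ = 0
  · simp [hξ]
  have hinv : 1 + ξ * (x / (1 - ξ * x)) = (1 - ξ * x)⁻¹ := by field_simp; ring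
  rw [gpdSurvival_of_ne_zero hξ (by positivity), gpdSurvival_of_ne_zero (neg_ne_zero.2 hξ) hx,
    hinv, neg_mul, ← sub_eq_add_neg, max_eq_right (by positivity), max_eq_right h.le,
    Real.inv_rpow h.le, ← Real.rpow_neg h.le, div_neg]

theorem gpdSurvival_lt_one (ξ : ℝ) (hx : 0 < x) : gpdSurvival ξ x < 1 := by
  rcases le_or_gt (1 + ξ * x) 0 with h | h
  · simp [gpdSurvival_eq_zero hx.le h]
  rcases lt_trichotomy ξ 0 with hξ | rfl | hξ
  · rw [gpdSurvival_of_ne_zero hξ.ne hx.le, max_eq_right h.le]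
    exact Real.rpow_lt_one h.le (by nlinarith) (div_pos_of_neg_of_neg (by norm_num) hξ)
  · rw [gpdSurvival_zero_left hx.le]
    exact Real.exp_lt_one_iff.mpr (by linarith)
  · rw [gpdSurvival_of_ne_zero hξ.ne' hx.le, max_eq_right h.le]
    exact Real.rpow_lt_one_of_one_lt_of_neg (by nlinarith [mul_pos hξ hx])
      (div_neg_of_neg_of_pos (by norm_num) hξ)

theorem gpdSurvival_lt_gpdSurvival (hx : 0 ≤ x) (hxy : x < y) (h : 0 < 1 + ξ * x) :
    gpdSurvival ξ y < gpdSurvival ξ x := by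
  have hz : 0 < (y - x) / (1 + ξ * x) := div_pos (sub_pos.2 hxy) h
  have hy : y = x + (1 + ξ * x) * ((y - x) / (1 + ξ * x)) := by
    rw [mul_div_cancel₀ _ h.ne', add_sub_cancel]
  rw [hy, gpdSurvival_add_mul hx hz.le h]
  exact mul_lt_of_lt_one_right (gpdSurvival_pos h) (gpdSurvival_lt_one ξ hz)

theorem antitone_gpdSurvival (ξ : ℝ) : Antitone (gpdSurvival ξ) := by
  intro x y hxy
  rw [← gpdSurvival_max_zero ξ x, ← gpdSurvival_max_zero ξ y]
  have hx : 0 ≤ max x 0 := le_max_right x 0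
  rcases (max_le_max_right 0 hxy).eq_or_lt with heq | hlt
  · rw [heq]
  rcases le_or_gt (1 + ξ * max x 0) 0 with h | h
  · have hy : 1 + ξ * max y 0 ≤ 0 := by nlinarith
    rw [gpdSurvival_eq_zero (hx.trans hlt.le) hy]
    exact gpdSurvival_nonneg ξ _
  · exact (gpdSurvival_lt_gpdSurvival hx hlt h).le

theorem continuous_gpdSurvival (ξ : ℝ) : Continuous (gpdSurvival ξ) := by
  unfold gpdSurvival
  split_ifs with hξ
  · fun_prop
  refine Continuous.rpow_const (by fun_prop) fun x => ?_
  rcases lt_or_gt_of_ne hξ with h | h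
  · exact Or.inr (div_pos_of_neg_of_neg (by norm_num) h).le
  · have : 0 < 1 + ξ * max x 0 := by positivity
    exact Or.inl (lt_max_of_lt_right this).ne'

theorem tendsto_gpdSurvival_atTop (ξ : ℝ) : Tendsto (gpdSurvival ξ) atTop (𝓝 0) := by
  rcases lt_trichotomy ξ 0 with hξ | rfl | hξ
  · refine tendsto_const_nhds.congr' ?_
    filter_upwards [eventually_ge_atTop (-1 / ξ), eventually_ge_atTop 0] with x hx hx0
    rw [div_le_iff_of_neg hξ] at hx
    exact (gpdSurvival_eq_zero hx0 (by linarith)).symm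
  · refine Real.tendsto_exp_neg_atTop_nhds_zero.congr' ?_
    filter_upwards [eventually_ge_atTop 0] with x hx
    exact (gpdSurvival_zero_left hx).symm
  · have haff : Tendsto (fun x : ℝ => 1 + ξ * x) atTop atTop :=
      tendsto_atTop_add_const_left _ _ (tendsto_id.const_mul_atTop hξ)
    refine ((tendsto_rpow_neg_atTop (one_div_pos.2 hξ)).comp haff).congr' ?_
    filter_upwards [eventually_ge_atTop 0] with x hx
    rw [gpdSurvival_of_ne_zero hξ.ne' hx, max_eq_right (by positivity), neg_div,
      Function.comp_apply]

theorem tendsto_of_tendsto_gpdSurvival {ι : Type*} {l : Filter ι} {u : ι → ℝ} (hy : 0 < y)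
    (hξy : 0 < 1 + ξ * y) (h : Tendsto (fun i => gpdSurvival ξ (u i)) l (𝓝 (gpdSurvival ξ y))) :
    Tendsto u l (𝓝 y) := by
  have hanti := antitone_gpdSurvival ξ
  refine tendsto_order.2 ⟨fun a ha => ?_, fun b hb => ?_⟩
  · have hlt : gpdSurvival ξ y < gpdSurvival ξ a := by
      rw [← gpdSurvival_max_zero ξ a]
      refine gpdSurvival_lt_gpdSurvival (le_max_right a 0) (max_lt ha hy) ?_
      rcases le_total 0 ξ with hξ | hξ
      · positivity
      · nlinarith [max_lt ha hy]
    exact (h.eventually (gt_mem_nhds hlt)).mono fun i hi => hanti.reflect_lt hi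
  · have hlt := gpdSurvival_lt_gpdSurvival hy.le hb hξy
    exact (h.eventually (lt_mem_nhds hlt)).mono fun i hi => hanti.reflect_lt hi

end GPDSurvival

section Polya

variable {ι : Type*} {F : ι → ℝ → ℝ} {G : ℝ → ℝ} {l : Filter ι} {a : ℝ}

theorem tendstoLocallyUniformlyOn_Ici_of_antitoneOn (hF : ∀ᶠ i in l, AntitoneOn (F i) (Ici a))
    (hG : ContinuousOn G (Ici a)) (h : ∀ x ∈ Ici a, Tendsto (F · x) l (𝓝 (G x))) :
    TendstoLocallyUniformlyOn F G l (Ici a) := by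
  refine Metric.tendstoLocallyUniformlyOn_iff.2 fun ε hε x hx => ?_
  obtain ⟨δ, hδ, hGδ⟩ := Metric.continuousOn_iff.1 hG x hx (ε / 4) (by positivity)
  set p := max a (x - δ / 2)
  set q := x + δ / 2 with hqx
  have hpx : p ≤ x := max_le hx (by linarith)
  have hxq : x ≤ q := by linarith
  have hp : p ∈ Ici a := le_max_left a (x - δ / 2)
  have hq : q ∈ Ici a := hx.trans hxq
  have hGpq : ∀ y ∈ Icc p q, |G y - G x| < ε / 4 := fun y hy => by
    refine hGδ y (hp.trans hy.1) (abs_lt.2 ⟨?_, ?_⟩)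
    · linarith [le_max_right a (x - δ / 2), hy.1]
    · linarith [hy.2, hqx]
  have hmem : Icc p q ∈ 𝓝[Ici a] x := by
    filter_upwards [self_mem_nhdsWithin, mem_nhdsWithin_of_mem_nhds
      (Icc_mem_nhds (show x - δ / 2 < x by linarith) (show x < x + δ / 2 by linarith))]
      with y hya hy
    exact ⟨max_le hya hy.1, hy.2⟩
  refine ⟨Icc p q, hmem, ?_⟩
  filter_upwards [hF, Metric.tendsto_nhds.1 (h p hp) (ε / 4) (by positivity),
    Metric.tendsto_nhds.1 (h q hq) (ε / 4) (by positivity)] with i hi hip hiq y hy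
  have hya : y ∈ Ici a := hp.trans hy.1
  have hFp := hi hp hya hy.1
  have hFq := hi hya hq hy.2
  have hGp := abs_lt.1 (hGpq p ⟨le_rfl, hpx.trans hxq⟩)
  have hGq := abs_lt.1 (hGpq q ⟨hpx.trans hxq, le_rfl⟩)
  have hGy := abs_lt.1 (hGpq y hy)
  rw [Real.dist_eq, abs_lt] at hip hiq ⊢
  constructor <;> linarith

theorem tendstoUniformlyOn_Ici_of_antitoneOn (hF : ∀ᶠ i in l, AntitoneOn (F i) (Ici a))
    (hF0 : ∀ᶠ i in l, ∀ x ∈ Ici a, 0 ≤ F i x) (hG : ContinuousOn G (Ici a))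
    (htop : Tendsto G atTop (𝓝 0)) (h : ∀ x ∈ Ici a, Tendsto (F · x) l (𝓝 (G x))) :
    TendstoUniformlyOn F G l (Ici a) := by
  refine Metric.tendstoUniformlyOn_iff.2 fun ε hε => ?_
  obtain ⟨M, hM⟩ := eventually_atTop.1 (Metric.tendsto_nhds.1 htop (ε / 3) (by positivity))
  have hcompact : TendstoUniformlyOn F G l (Icc a (max a M)) :=
    (tendstoLocallyUniformlyOn_iff_tendstoUniformlyOn_of_compact isCompact_Icc).1
      ((tendstoLocallyUniformlyOn_Ici_of_antitoneOn hF hG h).mono Icc_subset_Ici_self)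
  filter_upwards [hF, hF0, Metric.tendstoUniformlyOn_iff.1 hcompact (ε / 3) (by positivity)]
    with i hi hi0 hic x hx
  rcases le_total x (max a M) with hxM | hMx
  · linarith [hic x ⟨hx, hxM⟩]
  · have hcM := hic (max a M) ⟨le_max_left a M, le_rfl⟩
    have hGM := hM (max a M) (le_max_right a M)
    have hGx := hM x ((le_max_right a M).trans hMx)
    have hFx := hi (le_max_left a M) hx hMx
    have hFx0 := hi0 x hx
    rw [Real.dist_eq, abs_lt] at hcM hGM hGx ⊢
    constructor <;> linarith

end Polya

section TailFilter

/-- The filter of thresholds `t` with `0 < S t` that grow beyond every such threshold; for a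
survival function `S` these are the thresholds tending to the right endpoint from below. -/
def tailFilter (S : ℝ → ℝ) : Filter ℝ :=
  map ((↑) : {t | 0 < S t} → ℝ) atTop

variable {S : ℝ → ℝ} {T b : ℝ}

theorem eventually_pos_tailFilter (S : ℝ → ℝ) : ∀ᶠ t in tailFilter S, 0 < S t :=
  eventually_map.2 (Eventually.of_forall Subtype.prop)

theorem eventually_ge_tailFilter (hT : 0 < S T) : ∀ᶠ t in tailFilter S, T ≤ t :=
  eventually_map.2 (eventually_ge_atTop (⟨T, hT⟩ : {t | 0 < S t}))

theorem neBot_tailFilter (hT : 0 < S T) : (tailFilter S).NeBot := by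
  have : Nonempty {t | 0 < S t} := ⟨⟨T, hT⟩⟩
  exact map_neBot

theorem hasBasis_tailFilter (hT : 0 < S T) :
    (tailFilter S).HasBasis (fun u => 0 < S u) fun u => {t | u ≤ t ∧ 0 < S t} := by
  have : Nonempty {t | 0 < S t} := ⟨⟨T, hT⟩⟩
  refine ⟨fun s => ?_⟩
  rw [tailFilter, mem_map, mem_atTop_sets]
  constructor
  · rintro ⟨⟨u, hu⟩, h⟩
    exact ⟨u, hu, fun t ht => h ⟨t, ht.2⟩ ht.1⟩
  · rintro ⟨u, hu, h⟩
    exact ⟨⟨u, hu⟩, fun t ht => h ⟨ht, t.2⟩⟩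

theorem tendsto_tailFilter {ι : Type*} {m : Filter ι} {u : ι → ℝ}
    (hpos : ∀ᶠ i in m, 0 < S (u i)) (hge : ∀ t, 0 < S t → ∀ᶠ i in m, t ≤ u i) :
    Tendsto u m (tailFilter S) := by
  rcases m.eq_or_neBot with rfl | hm
  · exact tendsto_bot
  obtain ⟨i, hi⟩ := hpos.exists
  exact (hasBasis_tailFilter hi).tendsto_right_iff.2 fun t ht => (hge t ht).and hpos

theorem tailFilter_eq_atTop (h : ∀ t, 0 < S t) : tailFilter S = atTop :=
  ((hasBasis_tailFilter (h 0)).to_hasBasis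
    (fun u _ => ⟨u, trivial, fun _ ht => ⟨ht, h _⟩⟩)
    fun u _ => ⟨u, h u, fun _ ht => ht.1⟩).eq_of_same_basis atTop_basis

theorem tailFilter_eq_nhdsLT (hb : ∀ t, 0 < S t ↔ t < b) : tailFilter S = 𝓝[<] b := by
  have hset : {t | 0 < S t} = Iio b := Set.ext hb
  rw [tailFilter, hset, map_coe_Iio_atTop]

end TailFilter

/-- `S` is a GPD tail of shape `ξ` and scale `ψ`: rescaled by `ψ t`, its conditional tail over `t`
converges to the unit-scale generalized Pareto one. For `S t = P(X > t)` this is the limiting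
behaviour of the residual distribution, expressed without probability. -/
structure IsGPDTail (S : ℝ → ℝ) (ξ : ℝ) (ψ : ℝ → ℝ) : Prop where
  scale_pos : ∀ t, 0 < ψ t
  tendstoUniformlyOn : TendstoUniformlyOn (fun t x => S (t + x * ψ t) / S t) (gpdSurvival ξ)
    (tailFilter S) (Ici 0)

theorem tendsto_of_tendsto_mul_sub_mul {ι : Type*} {m : Filter ι} {u v w z : ι → ℝ} {k L : ℝ}
    (hk : 0 < k) (hu : ∀ᶠ i in m, k ≤ u i) (hwu : Tendsto (fun i => w i - u i) m (𝓝 0))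
    (hv : Tendsto v m (𝓝 L)) (h : Tendsto (fun i => v i * w i - u i * z i) m (𝓝 0)) :
    Tendsto z m (𝓝 L) := by
  have hdiff : Tendsto (fun i => u i * (z i - v i)) m (𝓝 0) := by
    refine Tendsto.congr (fun i => ?_) (by simpa using (hv.mul hwu).sub h)
    ring
  have hzv : Tendsto (fun i => z i - v i) m (𝓝 0) := by
    refine squeeze_zero_norm' (hu.mono fun i hi => ?_) (by simpa using hdiff.abs.div_const k)
    rw [Real.norm_eq_abs, le_div_iff₀ hk, abs_of_pos (hk.trans_le hi), mul_comm (u i)]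
    gcongr
  simpa using hzv.add hv

theorem exists_mem_Icc_lt_add_of_step {S δ : ℝ → ℝ} {p : ℝ → Prop} {q T u : ℝ} (hS : Antitone S)
    (hδ : ∀ t, 0 ≤ δ t) (hq0 : 0 ≤ q) (hq1 : q < 1) (hTu : T ≤ u) (hu : 0 < S u)
    (hstep : ∀ t ∈ Icc T u, S (t + δ t) ≤ q * S t) (hT : p T)
    (hp : ∀ t ∈ Icc T u, p t → p (t + δ t)) : ∃ v ∈ Icc T u, u < v + δ v ∧ p v := by
  -- Otherwise the steps from `T` never leave `[T, u]`, where `S` cannot decay geometrically.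
  by_contra! hstay
  have hiter : ∀ n : ℕ, ∃ v ∈ Icc T u, p v ∧ S v ≤ q ^ n * S T := by
    intro n
    induction n with
    | zero => exact ⟨T, ⟨le_rfl, hTu⟩, hT, by simp⟩
    | succ n ih =>
      obtain ⟨v, hv, hpv, hSv⟩ := ih
      have hle : v + δ v ≤ u := not_lt.1 fun hlt => hstay v hv hlt hpv
      refine ⟨v + δ v, ⟨hv.1.trans (le_add_of_nonneg_right (hδ v)), hle⟩, hp v hv hpv, ?_⟩
      calc S (v + δ v) ≤ q * S v := hstep v hv
        _ ≤ q * (q ^ n * S T) := by gcongr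
        _ = q ^ (n + 1) * S T := by ring
  have hlim : Tendsto (fun n : ℕ => q ^ n * S T) atTop (𝓝 0) := by
    simpa using (tendsto_pow_atTop_nhds_zero_of_lt_one hq0 hq1).mul_const (S T)
  refine hu.not_ge (ge_of_tendsto' hlim fun n => ?_)
  obtain ⟨v, hv, -, hSv⟩ := hiter n
  exact (hS hv.2).trans hSv

theorem exists_pos_le_one_one_add_mul_pos (ξ : ℝ) : ∃ c, 0 < c ∧ c ≤ 1 ∧ 0 < 1 + ξ * c := by
  refine ⟨(1 + |ξ|)⁻¹, by positivity, inv_le_one_of_one_le₀ (by linarith [abs_nonneg ξ]), ?_⟩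
  have hξ : 0 ≤ |ξ| + ξ := by linarith [neg_abs_le ξ]
  calc 0 < (1 + (|ξ| + ξ)) * (1 + |ξ|)⁻¹ := by positivity
    _ = 1 + ξ * (1 + |ξ|)⁻¹ := by field_simp; ring

theorem one_add_mul_pos_of_mem_Icc {ξ c x : ℝ} (hc : 0 < 1 + ξ * c) (hx : x ∈ Icc 0 c) :
    0 < 1 + ξ * x := by
  rcases le_total 0 ξ with hξ | hξ
  · have := hx.1
    positivity
  · nlinarith [hx.2]

namespace IsGPDTail

variable {S ψ : ℝ → ℝ} {ξ c : ℝ}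

theorem of_tendsto (hS : Antitone S) (hS0 : ∀ t, 0 ≤ S t) (hψ : ∀ t, 0 < ψ t)
    (h : ∀ x, 0 ≤ x →
      Tendsto (fun t => S (t + x * ψ t) / S t) (tailFilter S) (𝓝 (gpdSurvival ξ x))) :
    IsGPDTail S ξ ψ where
  scale_pos := hψ
  tendstoUniformlyOn := by
    refine tendstoUniformlyOn_Ici_of_antitoneOn (Eventually.of_forall fun t x _ y _ hxy => ?_)
      (Eventually.of_forall fun t x _ => div_nonneg (hS0 _) (hS0 _))
      (continuous_gpdSurvival ξ).continuousOn (tendsto_gpdSurvival_atTop ξ) h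
    have hle : t + x * ψ t ≤ t + y * ψ t := by
      gcongr
      exact (hψ t).le
    exact div_le_div_of_nonneg_right (hS hle) (hS0 t)

section Filter

variable {ι : Type*} {m : Filter ι} {t x : ι → ℝ}

theorem tendsto_sub_gpdSurvival (h : IsGPDTail S ξ ψ) (ht : Tendsto t m (tailFilter S))
    (hx : ∀ᶠ i in m, 0 ≤ x i) :
    Tendsto (fun i => S (t i + x i * ψ (t i)) / S (t i) - gpdSurvival ξ (x i)) m (𝓝 0) := by
  refine Metric.tendsto_nhds.2 fun ε hε => ?_
  filter_upwards [ht.eventually (Metric.tendstoUniformlyOn_iff.1 h.tendstoUniformlyOn ε hε), hx]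
    with i hi hxi
  simpa [Real.dist_eq, abs_sub_comm] using hi (x i) hxi

theorem tendsto_div (h : IsGPDTail S ξ ψ) (ht : Tendsto t m (tailFilter S))
    (hx0 : ∀ᶠ i in m, 0 ≤ x i) {y : ℝ} (hx : Tendsto x m (𝓝 y)) :
    Tendsto (fun i => S (t i + x i * ψ (t i)) / S (t i)) m (𝓝 (gpdSurvival ξ y)) := by
  have hK := ((continuous_gpdSurvival ξ).tendsto y).comp hx
  simpa using (h.tendsto_sub_gpdSurvival ht hx0).add hK

theorem tendsto_add_mul_tailFilter (h : IsGPDTail S ξ ψ) (hc : 0 < 1 + ξ * c)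
    (ht : Tendsto t m (tailFilter S)) (hx : ∀ᶠ i in m, x i ∈ Icc 0 c) :
    Tendsto (fun i => t i + x i * ψ (t i)) m (tailFilter S) := by
  refine tendsto_tailFilter ?_ fun T hT => ?_
  · filter_upwards [hx, ht.eventually (eventually_pos_tailFilter S),
      (h.tendsto_sub_gpdSurvival ht (hx.mono fun _ hi => hi.1)).eventually
        (lt_mem_nhds (neg_lt_zero.2 (gpdSurvival_pos hc)))] with i hxi hSi hi
    have hK := antitone_gpdSurvival ξ hxi.2
    exact (div_pos_iff_of_pos_right hSi).1 (by linarith)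
  · filter_upwards [hx, ht.eventually (eventually_ge_tailFilter hT)] with i hxi hTi
    exact hTi.trans (le_add_of_nonneg_right (mul_nonneg hxi.1 (h.scale_pos _).le))

/-- Two steps, of lengths `x * ψ t` and then `c * ψ t'` with `t' = t + x * ψ t`, make a single
step of length `(x + (1 + ξ * x) * z) * ψ t`, so `gpdSurvival ξ z` tends to `gpdSurvival ξ c`. -/
theorem tendsto_scale_div (h : IsGPDTail S ξ ψ) (hc0 : 0 < c) (hc : 0 < 1 + ξ * c)
    (ht : Tendsto t m (tailFilter S)) (hx : ∀ᶠ i in m, x i ∈ Icc 0 c) :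
    Tendsto (fun i => ψ (t i + x i * ψ (t i)) / ((1 + ξ * x i) * ψ (t i))) m (𝓝 1) := by
  set t' := fun i => t i + x i * ψ (t i)
  set z := fun i => c * (ψ (t' i) / ((1 + ξ * x i) * ψ (t i)))
  have hx0 : ∀ᶠ i in m, 0 ≤ x i := hx.mono fun _ hi => hi.1
  have ht' : Tendsto t' m (tailFilter S) := h.tendsto_add_mul_tailFilter hc ht hx
  have hz0 : ∀ᶠ i in m, 0 ≤ z i := hx.mono fun i hi => by
    have := one_add_mul_pos_of_mem_Icc hc hi
    have := h.scale_pos (t i)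
    have := h.scale_pos (t' i)
    positivity
  have hxz : ∀ᶠ i in m, 0 ≤ x i + (1 + ξ * x i) * z i := by
    filter_upwards [hx, hz0] with i hxi hzi
    exact add_nonneg hxi.1 (mul_nonneg (one_add_mul_pos_of_mem_Icc hc hxi).le hzi)
  have hfirst := h.tendsto_sub_gpdSurvival ht hx0
  have hsecond := h.tendsto_div ht' (Eventually.of_forall fun _ => hc0.le) tendsto_const_nhds
  have hboth := h.tendsto_sub_gpdSurvival ht hxz
  suffices hKz : Tendsto (fun i => gpdSurvival ξ (z i)) m (𝓝 (gpdSurvival ξ c)) by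
    simpa [z, hc0.ne'] using (tendsto_of_tendsto_gpdSurvival hc0 hc hKz).div_const c
  refine tendsto_of_tendsto_mul_sub_mul (gpdSurvival_pos hc)
    (hx.mono fun i hi => antitone_gpdSurvival ξ hi.2) hfirst hsecond (hboth.congr' ?_)
  filter_upwards [hx, hz0, ht'.eventually (eventually_pos_tailFilter S)] with i hxi hzi hSi
  have hpos := one_add_mul_pos_of_mem_Icc hc hxi
  have hz : (1 + ξ * x i) * z i * ψ (t i) = c * ψ (t' i) := by
    have hne := (mul_pos hpos (h.scale_pos (t i))).ne'
    rw [mul_right_comm, mul_left_comm, mul_div_cancel₀ _ hne]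
  rw [gpdSurvival_add_mul hxi.1 hzi hpos, add_mul, hz, ← add_assoc, div_mul_div_cancel₀ hSi.ne']

end Filter

theorem eventually_forall_abs_scale_sub_le (h : IsGPDTail S ξ ψ) (hc0 : 0 < c)
    (hc : 0 < 1 + ξ * c) {ε : ℝ} (hε : 0 < ε) :
    ∀ᶠ t in tailFilter S, ∀ u ∈ Icc t (t + c * ψ t),
      |ψ u - ψ t - ξ * (u - t)| ≤ ε * (c * ψ t) := by
  set B := 1 + |ξ| * c
  have hB : 0 < B := by positivity
  have hmem : ∀ᶠ i : ℝ × ℝ in tailFilter S ×ˢ 𝓟 (Icc 0 c), i.2 ∈ Icc 0 c :=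
    tendsto_snd.eventually (mem_principal_self _)
  have hlim := h.tendsto_scale_div hc0 hc tendsto_fst hmem
  filter_upwards [eventually_prod_principal_iff.1
    (Metric.tendsto_nhds.1 hlim (ε * c / B) (by positivity))] with t ht u hu
  have hψ := h.scale_pos t
  set x := (u - t) / ψ t
  have hxψ : x * ψ t = u - t := div_mul_cancel₀ _ hψ.ne'
  have hx : x ∈ Icc 0 c :=
    ⟨div_nonneg (sub_nonneg.2 hu.1) hψ.le, (div_le_iff₀ hψ).2 (by linarith [hu.2])⟩
  have hpos := one_add_mul_pos_of_mem_Icc hc hx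
  have hxB : 1 + ξ * x ≤ B := by
    have := mul_le_mul (le_abs_self ξ) hx.2 hx.1 (abs_nonneg ξ)
    linarith
  have hdist := ht x hx
  rw [hxψ, add_sub_cancel, Real.dist_eq, div_sub_one (by positivity), abs_div,
    abs_of_pos (mul_pos hpos hψ), div_lt_iff₀ (by positivity)] at hdist
  calc |ψ u - ψ t - ξ * (u - t)| = |ψ u - (1 + ξ * x) * ψ t| := by rw [← hxψ]; ring_nf
    _ ≤ ε * c / B * ((1 + ξ * x) * ψ t) := hdist.le
    _ ≤ ε * c / B * (B * ψ t) := by gcongr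
    _ = ε * (c * ψ t) := by field_simp

theorem eventually_step_le (h : IsGPDTail S ξ ψ) {q : ℝ} (hc : 0 ≤ c)
    (hq : gpdSurvival ξ c < q) : ∀ᶠ t in tailFilter S, S (t + c * ψ t) ≤ q * S t := by
  filter_upwards [(h.tendsto_div tendsto_id (Eventually.of_forall fun _ => hc)
    tendsto_const_nhds).eventually (gt_mem_nhds hq), eventually_pos_tailFilter S] with t ht hSt
  exact ((div_lt_iff₀ hSt).1 ht).le

theorem eventually_forall_ge_exists_abs_scale_sub_le (h : IsGPDTail S ξ ψ) (hS : Antitone S)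
    {ε : ℝ} (hε : 0 < ε) :
    ∀ᶠ t in tailFilter S, ∀ u, t ≤ u → 0 < S u → ∃ v ∈ Icc t u,
      |ψ v - ψ t - ξ * (v - t)| ≤ ε * (v - t) ∧ |ψ u - ψ v - ξ * (u - v)| ≤ ε * ψ v := by
  rcases (tailFilter S).eq_or_neBot with hbot | _
  · simp [hbot]
  obtain ⟨c, hc0, hc1, hc⟩ := exists_pos_le_one_one_add_mul_pos ξ
  obtain ⟨q, hKq, hq1⟩ := exists_between (gpdSurvival_lt_one ξ hc0)
  obtain ⟨T₀, hT₀⟩ := (eventually_pos_tailFilter S).exists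
  obtain ⟨T, hST, hT⟩ := (hasBasis_tailFilter hT₀).eventually_iff.1
    ((h.eventually_forall_abs_scale_sub_le hc0 hc hε).and (h.eventually_step_le hc0.le hKq))
  filter_upwards [eventually_ge_tailFilter hST] with t htT u htu hu
  have hlocal : ∀ v ∈ Icc t u, T ≤ v ∧ 0 < S v :=
    fun v hv => ⟨htT.trans hv.1, hu.trans_le (hS hv.2)⟩
  obtain ⟨v, hv, huv, htv⟩ : ∃ v ∈ Icc t u, u < v + c * ψ v ∧
      |ψ v - ψ t - ξ * (v - t)| ≤ ε * (v - t) := by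
    refine exists_mem_Icc_lt_add_of_step hS (fun v => (mul_pos hc0 (h.scale_pos v)).le)
      ((gpdSurvival_nonneg ξ c).trans hKq.le) hq1 htu hu (fun v hv => (hT (hlocal v hv)).2)
      (by simp) fun v hv hpv => ?_
    have hψ := mul_pos hc0 (h.scale_pos v)
    have hstep := (hT (hlocal v hv)).1 (v + c * ψ v) ⟨by linarith, le_rfl⟩
    rw [abs_le] at hpv hstep ⊢
    constructor <;> linarith
  refine ⟨v, hv, htv, ((hT (hlocal v hv)).1 u ⟨hv.2, huv.le⟩).trans ?_⟩
  exact mul_le_mul_of_nonneg_left (mul_le_of_le_one_left (h.scale_pos v).le hc1) hε.le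

theorem eventually_forall_ge_abs_scale_sub_le (h : IsGPDTail S ξ ψ) (hS : Antitone S) {ε : ℝ}
    (hε : 0 < ε) :
    ∀ᶠ t in tailFilter S, ∀ u, t ≤ u → 0 < S u →
      |ψ u - ψ t - ξ * (u - t)| ≤ ε * (ψ t + (u - t)) := by
  obtain ⟨η, hη0, hη1, hηε⟩ : ∃ η > 0, η ≤ 1 ∧ η * (2 + |ξ|) ≤ ε :=
    ⟨min 1 (ε / (2 + |ξ|)), by positivity, min_le_left _ _,
      (le_div_iff₀ (by positivity)).1 (min_le_right _ _)⟩
  filter_upwards [h.eventually_forall_ge_exists_abs_scale_sub_le hS hη0] with t ht u htu hu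
  obtain ⟨v, hv, htv, hvu⟩ := ht u htu hu
  have hψt := h.scale_pos t
  have hvt : 0 ≤ v - t := sub_nonneg.2 hv.1
  have hψv : ψ v ≤ ψ t + (1 + |ξ|) * (v - t) := by
    have := mul_le_mul_of_nonneg_right (le_abs_self ξ) hvt
    have := mul_le_mul_of_nonneg_right hη1 hvt
    linarith [le_of_abs_le htv]
  calc |ψ u - ψ t - ξ * (u - t)|
      = |(ψ v - ψ t - ξ * (v - t)) + (ψ u - ψ v - ξ * (u - v))| := by ring_nf
    _ ≤ |ψ v - ψ t - ξ * (v - t)| + |ψ u - ψ v - ξ * (u - v)| := abs_add_le _ _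
    _ ≤ η * (v - t) + η * (ψ t + (1 + |ξ|) * (v - t)) := by
        refine add_le_add htv (hvu.trans ?_)
        gcongr
    _ ≤ η * (2 + |ξ|) * (ψ t + (v - t)) := by
        linarith [mul_pos hη0 hψt, mul_nonneg (mul_nonneg hη0.le (abs_nonneg ξ)) hψt.le]
    _ ≤ ε * (ψ t + (u - t)) := by
        gcongr
        exact hv.2

theorem tendsto_scale_div_sub_of_forall_pos (h : IsGPDTail S ξ ψ) (hS : Antitone S)
    (hpos : ∀ t, 0 < S t) (a : ℝ) :
    Tendsto (fun t => ψ t / (t - a)) (tailFilter S) (𝓝 ξ) := by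
  rw [tailFilter_eq_atTop hpos]
  refine Metric.tendsto_nhds.2 fun ε hε => ?_
  have haffine := h.eventually_forall_ge_abs_scale_sub_le hS (half_pos hε)
  rw [tailFilter_eq_atTop hpos] at haffine
  obtain ⟨t, ht⟩ := haffine.exists
  set C := (1 + ε / 2) * ψ t + ε / 2 * (a - t) + |ξ * (a - t)|
  filter_upwards [eventually_ge_atTop t, eventually_gt_atTop (a + C / (ε / 2)),
    eventually_gt_atTop a] with u htu hCu hau
  have hua : 0 < u - a := sub_pos.2 hau
  have hC : C < (u - a) * (ε / 2) := (div_lt_iff₀ (half_pos hε)).1 (by linarith)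
  have hu := abs_le.1 (ht u htu (hpos u))
  have hξ := abs_le.1 (le_refl |ξ * (a - t)|)
  have hψt := h.scale_pos t
  rw [Real.dist_eq, div_sub' hua.ne', abs_div, abs_of_pos hua, div_lt_iff₀ hua, abs_lt]
  have : ε / 2 * ψ t > 0 := by positivity
  simp only [C] at hC
  constructor <;> linarith

theorem eventually_mul_scale_lt_sub {b : ℝ} (h : IsGPDTail S ξ ψ) (hb : ∀ t, 0 < S t ↔ t < b)
    (hc0 : 0 ≤ c) (hc : 0 < 1 + ξ * c) : ∀ᶠ t in tailFilter S, c * ψ t < b - t := by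
  have hstep := h.tendsto_add_mul_tailFilter hc tendsto_id
    (Eventually.of_forall fun _ => right_mem_Icc.2 hc0)
  filter_upwards [hstep.eventually (eventually_pos_tailFilter S)] with t ht
  exact lt_sub_iff_add_lt'.2 ((hb _).1 ht)

theorem tendsto_scale_nhds_zero {b : ℝ} (h : IsGPDTail S ξ ψ) (hb : ∀ t, 0 < S t ↔ t < b) :
    Tendsto ψ (tailFilter S) (𝓝 0) := by
  obtain ⟨c, hc0, -, hc⟩ := exists_pos_le_one_one_add_mul_pos ξ
  have hdist : Tendsto (fun t => (b - t) / c) (tailFilter S) (𝓝 0) := by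
    rw [tailFilter_eq_nhdsLT hb]
    refine tendsto_nhdsWithin_of_tendsto_nhds (Continuous.tendsto' (by fun_prop) _ _ (by simp))
  refine squeeze_zero' (Eventually.of_forall fun t => (h.scale_pos t).le) ?_ hdist
  filter_upwards [h.eventually_mul_scale_lt_sub hb hc0.le hc] with t ht
  exact (le_div_iff₀' hc0).2 ht.le

theorem eventually_abs_scale_add_mul_sub_le {b ε : ℝ} (h : IsGPDTail S ξ ψ) (hS : Antitone S)
    (hb : ∀ t, 0 < S t ↔ t < b) (hε : 0 < ε) :
    ∀ᶠ t in tailFilter S, |ψ t + ξ * (b - t)| ≤ ε * (ψ t + (b - t)) := by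
  have hu : Tendsto (fun u => u) (tailFilter S) (𝓝 b) := by
    rw [tailFilter_eq_nhdsLT hb]
    exact tendsto_nhdsWithin_of_tendsto_nhds tendsto_id
  have : (tailFilter S).NeBot := by
    rw [tailFilter_eq_nhdsLT hb]
    infer_instance
  filter_upwards [h.eventually_forall_ge_abs_scale_sub_le hS hε, eventually_pos_tailFilter S]
    with t ht hSt
  have hle : ∀ᶠ u in tailFilter S, |ψ u - ψ t - ξ * (u - t)| ≤ ε * (ψ t + (u - t)) := by
    filter_upwards [eventually_ge_tailFilter hSt, eventually_pos_tailFilter S] with u htu hSu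
    exact ht u htu hSu
  have hlim := le_of_tendsto_of_tendsto
    (((h.tendsto_scale_nhds_zero hb).sub_const (ψ t)).sub ((hu.sub_const t).const_mul ξ)).abs
    (((hu.sub_const t).const_add (ψ t)).const_mul ε) hle
  rwa [zero_sub, ← neg_add', abs_neg] at hlim

theorem tendsto_scale_div_sub_of_forall_pos_iff_lt {b : ℝ} (h : IsGPDTail S ξ ψ)
    (hS : Antitone S) (hb : ∀ t, 0 < S t ↔ t < b) :
    Tendsto (fun t => ψ t / (t - b)) (tailFilter S) (𝓝 ξ) := by
  obtain ⟨c, hc0, -, hc⟩ := exists_pos_le_one_one_add_mul_pos ξ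
  refine Metric.tendsto_nhds.2 fun ε hε => ?_
  set η := ε / (2 * (1 / c + 1))
  have hη : 0 < η := by positivity
  filter_upwards [h.eventually_abs_scale_add_mul_sub_le hS hb hη,
    h.eventually_mul_scale_lt_sub hb hc0.le hc, eventually_pos_tailFilter S] with t ht hψt hSt
  have htb : 0 < b - t := sub_pos.2 ((hb t).1 hSt)
  have hψ : ψ t ≤ 1 / c * (b - t) := by
    rw [one_div, ← div_eq_inv_mul, le_div_iff₀' hc0]
    exact hψt.le
  rw [Real.dist_eq, ← neg_sub b t, div_neg, ← abs_neg, neg_sub, sub_neg_eq_add,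
    add_div' _ _ _ htb.ne', abs_div, abs_of_pos htb, div_lt_iff₀ htb, add_comm]
  calc |ψ t + ξ * (b - t)| ≤ η * (1 / c * (b - t) + (b - t)) := ht.trans (by gcongr)
    _ = ε / 2 * (b - t) := by
        simp only [η]
        field_simp
    _ < ε * (b - t) := by
        gcongr
        exact half_lt_self hε

theorem tendsto_zero (h : IsGPDTail S ξ ψ) (hS : Antitone S) (hS0 : ∀ t, 0 ≤ S t) :
    Tendsto S (tailFilter S) (𝓝 0) := by
  rcases (tailFilter S).eq_or_neBot with hbot | _
  · simp [hbot]
  obtain ⟨c, hc0, -, hc⟩ := exists_pos_le_one_one_add_mul_pos ξ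
  obtain ⟨L, hL⟩ : ∃ L, Tendsto S (tailFilter S) (𝓝 L) :=
    ⟨_, tendsto_map'_iff.2 (tendsto_atTop_ciInf (fun _ _ hst => hS hst)
      ⟨0, forall_mem_range.2 fun t => hS0 t⟩)⟩
  suffices hL0 : L = 0 by rwa [hL0] at hL
  by_contra hL0
  have hcIcc : ∀ᶠ t in tailFilter S, c ∈ Icc 0 c :=
    Eventually.of_forall fun _ => right_mem_Icc.2 hc0.le
  have hratio := (hL.comp (h.tendsto_add_mul_tailFilter hc tendsto_id hcIcc)).div hL hL0
  rw [div_self hL0] at hratio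
  exact (gpdSurvival_lt_one ξ hc0).ne' (tendsto_nhds_unique hratio
    (h.tendsto_div tendsto_id (Eventually.of_forall fun _ => hc0.le) tendsto_const_nhds))

end IsGPDTail

section Survival

variable {Ω : Type*} [MeasurableSpace Ω]

/-- The survival function `t ↦ P(X > t)` of `X`. -/
noncomputable def survival (P : Measure Ω) (X : Ω → ℝ) (t : ℝ) : ℝ :=
  P.real {ω | t < X ω}

variable {P : Measure Ω} {X : Ω → ℝ}

theorem survival_nonneg (t : ℝ) : 0 ≤ survival P X t := measureReal_nonneg

variable [IsProbabilityMeasure P]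

theorem antitone_survival : Antitone (survival P X) := fun _ _ h =>
  measureReal_mono fun _ hω => lt_of_le_of_lt h hω

theorem cdf_map_eq_one_sub_survival (hX : Measurable X) (t : ℝ) :
    cdf (P.map X) t = 1 - survival P X t := by
  have := Measure.isProbabilityMeasure_map (μ := P) hX.aemeasurable
  rw [cdf_eq_real, map_measureReal_apply hX measurableSet_Iic, survival,
    ← probReal_compl_eq_one_sub (measurableSet_lt measurable_const hX)]
  congr 1
  ext ω
  simp

theorem exists_survival_pos (hX : Measurable X) : ∃ t, 0 < survival P X t := by
  obtain ⟨t, ht⟩ := ((tendsto_cdf_atBot (P.map X)).eventually_lt_const one_pos).exists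
  rw [cdf_map_eq_one_sub_survival hX] at ht
  exact ⟨t, by linarith⟩

theorem exists_gt_survival_pos (hX : Measurable X) {t : ℝ} (ht : 0 < survival P X t) :
    ∃ u, t < u ∧ 0 < survival P X u := by
  have hcont : Tendsto (survival P X) (𝓝[>] t) (𝓝 (survival P X t)) := by
    have hcdf := ((cdf (P.map X)).right_continuous t).mono Ioi_subset_Ici_self
    simpa [ContinuousWithinAt, cdf_map_eq_one_sub_survival hX] using hcdf.const_sub 1
  exact (eventually_mem_nhdsWithin.and (hcont.eventually_const_lt ht)).exists

theorem lt_rightEndpoint_iff (hX : Measurable X) (t : ℝ) :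
    (t : EReal) < rightEndpoint P X ↔ 0 < survival P X t := by
  simp only [rightEndpoint, lt_sSup_iff, mem_image, mem_ofPred_eq, exists_exists_and_eq_and,
    cdf_map_eq_one_sub_survival hX, EReal.coe_lt_coe_iff, sub_lt_self_iff]
  constructor
  · rintro ⟨u, hu, htu⟩
    exact hu.trans_le (antitone_survival htu.le)
  · intro ht
    obtain ⟨u, htu, hu⟩ := exists_gt_survival_pos hX ht
    exact ⟨u, hu, htu⟩

theorem highThresholds_eq_tailFilter (hX : Measurable X) :
    highThresholds P X = tailFilter (survival P X) := by
  obtain ⟨t₀, ht₀⟩ := exists_survival_pos (P := P) hX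
  have hbasis := (nhdsLT_basis_of_exists_lt ⟨_, (lt_rightEndpoint_iff hX t₀).2 ht₀⟩).comap
    (fun t : ℝ => (t : EReal))
  refine hbasis.ext (hasBasis_tailFilter ht₀) (fun e he => ?_) fun u hu => ?_
  · obtain ⟨u, heu, hu⟩ := EReal.lt_iff_exists_real_btwn.1 he
    exact ⟨u, (lt_rightEndpoint_iff hX u).1 hu, fun t ht =>
      ⟨heu.trans_le (EReal.coe_le_coe_iff.2 ht.1), (lt_rightEndpoint_iff hX t).2 ht.2⟩⟩
  · exact ⟨u, (lt_rightEndpoint_iff hX u).2 hu, fun t ht =>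
      ⟨EReal.coe_le_coe_iff.1 ht.1.le, (lt_rightEndpoint_iff hX t).1 ht.2⟩⟩

theorem cdf_residualLaw (hX : Measurable X) {t : ℝ} (ht : 0 < survival P X t) (x : ℝ) :
    cdf (residualLaw P X t) x = 1 - survival P X (t + max x 0) / survival P X t := by
  have hne : P {ω | t < X ω} ≠ 0 := (measureReal_ne_zero_iff (measure_ne_top _ _)).1 ht.ne'
  have := cond_isProbabilityMeasure hne
  have hXt : Measurable fun ω => X ω - t := hX.sub_const t
  have hpre : (fun ω => X ω - t) ⁻¹' Iic x = {ω | t + x < X ω}ᶜ := by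
    ext ω
    simp [add_comm]
  have hinter : {ω | t < X ω} ∩ {ω | t + x < X ω} = {ω | t + max x 0 < X ω} := by
    ext ω
    simp [← max_add_add_left, and_comm]
  have : IsProbabilityMeasure (residualLaw P X t) :=
    Measure.isProbabilityMeasure_map hXt.aemeasurable
  rw [cdf_eq_real, residualLaw, map_measureReal_apply hXt measurableSet_Iic, hpre,
    probReal_compl_eq_one_sub (measurableSet_lt measurable_const hX),
    measureReal_def, cond_apply (measurableSet_lt measurable_const hX), hinter, ENNReal.toReal_mul,
    ENNReal.toReal_inv, div_eq_inv_mul]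
  rfl

theorem residualLimitGPD_iff (hX : Measurable X) (ξ : ℝ) :
    ResidualLimitGPD P X ξ ↔ ∃ ψ, IsGPDTail (survival P X) ξ ψ := by
  have hcdf : ∀ {ψ : ℝ → ℝ}, (∀ t, 0 < ψ t) → ∀ {t}, 0 < survival P X t → ∀ x,
      cdf (residualLaw P X t) x - gpdCDF ξ (ψ t) x = gpdSurvival ξ (max (x / ψ t) 0) -
        survival P X (t + max (x / ψ t) 0 * ψ t) / survival P X t := fun {ψ} hψ {t} ht x => by
    have hmax : max (x / ψ t) 0 * ψ t = max x 0 := by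
      rw [max_mul_of_nonneg _ _ (hψ t).le, zero_mul, div_mul_cancel₀ _ (hψ t).ne']
    rw [cdf_residualLaw hX ht, gpdCDF_eq_one_sub_gpdSurvival (hψ t), hmax, gpdSurvival_max_zero]
    ring
  simp only [ResidualLimitGPD, highThresholds_eq_tailFilter hX, Metric.tendstoUniformly_iff,
    dist_zero_left, Real.norm_eq_abs]
  refine exists_congr fun ψ => ⟨fun ⟨hψ, h⟩ => ⟨hψ, ?_⟩, fun h => ⟨h.scale_pos, fun ε hε => ?_⟩⟩
  · refine Metric.tendstoUniformlyOn_iff.2 fun ε hε => ?_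
    filter_upwards [h ε hε, eventually_pos_tailFilter _] with t ht hSt x hx
    simpa [hcdf hψ hSt, (hψ t).ne', max_eq_left (mem_Ici.1 hx), Real.dist_eq] using ht (x * ψ t)
  · filter_upwards [Metric.tendstoUniformlyOn_iff.1 h.tendstoUniformlyOn ε hε,
      eventually_pos_tailFilter _] with t ht hSt x
    rw [hcdf h.scale_pos hSt, ← Real.dist_eq]
    exact ht _ (le_max_right (x / ψ t) 0)

end Survival

section Reciprocal

variable {S S' ψ : ℝ → ℝ} {ξ a y : ℝ} {I : Set ℝ}

theorem strictMonoOn_neg_one_div_sub (hI : I = Ioi a ∨ I = Iio a) :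
    StrictMonoOn (fun x => -1 / (x - a)) I := by
  intro x hx y hy hxy
  simp only [neg_div, neg_lt_neg_iff]
  rcases hI with rfl | rfl
  · exact one_div_lt_one_div_of_lt (sub_pos.2 hx) (sub_lt_sub_right hxy a)
  · exact one_div_lt_one_div_of_neg_of_lt (sub_neg.2 hy) (sub_lt_sub_right hxy a)

theorem ne_of_mem_Ioi_or_Iio (hI : I = Ioi a ∨ I = Iio a) {x : ℝ} (hx : x ∈ I) : x ≠ a := by
  rcases hI with rfl | rfl
  exacts [hx.ne', hx.ne]

theorem add_mul_sub_mem_of_mem_Ioi_or_Iio (hI : I = Ioi a ∨ I = Iio a) {r x : ℝ} (hr : 0 < r)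
    (hx : x ∈ I) : a + r * (x - a) ∈ I := by
  rcases hI with rfl | rfl
  · exact lt_add_of_pos_right a (mul_pos hr (sub_pos.2 hx))
  · exact add_lt_of_neg_right a (mul_neg_of_pos_of_neg hr (sub_neg.2 hx))

/-- The scale function of `-1 / (X - a)` when `ψ` is that of `X`, namely `s² ψ(t)` at the image
`s = -1 / (t - a)` of the threshold `t`; the value at `0`, which is no such image, is arbitrary. -/
noncomputable def reciprocalScale (ψ : ℝ → ℝ) (a s : ℝ) : ℝ :=
  if s = 0 then 1 else s ^ 2 * ψ (a - 1 / s)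

theorem reciprocalScale_pos (hψ : ∀ t, 0 < ψ t) (a s : ℝ) : 0 < reciprocalScale ψ a s := by
  unfold reciprocalScale
  split_ifs with hs
  · exact one_pos
  · exact mul_pos (by positivity) (hψ _)

theorem reciprocalScale_neg_one_div_sub (ψ : ℝ → ℝ) {t : ℝ} (ht : t ≠ a) :
    reciprocalScale ψ a (-1 / (t - a)) = ψ t / (t - a) ^ 2 := by
  have hta : t - a ≠ 0 := sub_ne_zero.2 ht
  have harg : a - 1 / (-1 / (t - a)) = t := by
    field_simp
    ring
  rw [reciprocalScale, if_neg (div_ne_zero (by norm_num) hta), harg]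
  field_simp

namespace IsGPDTail

theorem tendsto_reciprocal_of_mul_lt_one (h : IsGPDTail S ξ ψ) (hI : I = Ioi a ∨ I = Iio a)
    (hmem : ∀ᶠ t in tailFilter S, t ∈ I)
    (hρ : Tendsto (fun t => ψ t / (t - a)) (tailFilter S) (𝓝 ξ))
    (hS' : ∀ t ∈ I, S' (-1 / (t - a)) = S t) (hy : 0 ≤ y) (hξy : ξ * y < 1) :
    Tendsto (fun t => S' (-1 / (t - a) + y * reciprocalScale ψ a (-1 / (t - a))) /
      S' (-1 / (t - a))) (tailFilter S) (𝓝 (gpdSurvival (-ξ) y)) := by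
  have hpos : 0 < 1 - ξ * y := sub_pos.2 hξy
  have hden : Tendsto (fun t => 1 - ψ t / (t - a) * y) (tailFilter S) (𝓝 (1 - ξ * y)) :=
    (hρ.mul_const y).const_sub 1
  have hden0 := hden.eventually_const_lt hpos
  have hx0 : ∀ᶠ t in tailFilter S, 0 ≤ y / (1 - ψ t / (t - a) * y) :=
    hden0.mono fun t ht => div_nonneg hy ht.le
  rw [← gpdSurvival_div_one_sub_mul hy hpos]
  refine (h.tendsto_div tendsto_id hx0 (tendsto_const_nhds.div hden hpos.ne')).congr' ?_
  filter_upwards [hmem, hden0] with t ht hdent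
  have hta : t - a ≠ 0 := sub_ne_zero.2 (ne_of_mem_Ioi_or_Iio hI ht)
  set ρ := ψ t / (t - a)
  have hψ : ψ t = ρ * (t - a) := (div_mul_cancel₀ _ hta).symm
  set u := a + (1 - ρ * y)⁻¹ * (t - a)
  have hu : u ∈ I := add_mul_sub_mem_of_mem_Ioi_or_Iio hI (inv_pos.2 hdent) ht
  have htu : t + y / (1 - ρ * y) * ψ t = u := by
    simp only [u, hψ]
    linear_combination (a - t) * mul_inv_cancel₀ hdent.ne'
  have hsu : -1 / (t - a) + y * reciprocalScale ψ a (-1 / (t - a)) = -1 / (u - a) := by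
    rw [reciprocalScale_neg_one_div_sub ψ (ne_of_mem_Ioi_or_Iio hI ht)]
    simp only [u, hψ, add_sub_cancel_left]
    field_simp
    ring
  rw [id, htu, hsu, hS' u hu, hS' t ht]

theorem tendsto_reciprocal (h : IsGPDTail S ξ ψ) (hI : I = Ioi a ∨ I = Iio a)
    (hmem : ∀ᶠ t in tailFilter S, t ∈ I)
    (hρ : Tendsto (fun t => ψ t / (t - a)) (tailFilter S) (𝓝 ξ)) (hanti : Antitone S')
    (hS'0 : ∀ s, 0 ≤ S' s) (hS' : ∀ t ∈ I, S' (-1 / (t - a)) = S t) (hy : 0 ≤ y) :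
    Tendsto (fun t => S' (-1 / (t - a) + y * reciprocalScale ψ a (-1 / (t - a))) /
      S' (-1 / (t - a))) (tailFilter S) (𝓝 (gpdSurvival (-ξ) y)) := by
  rcases lt_or_ge (ξ * y) 1 with hξy | hξy
  · exact h.tendsto_reciprocal_of_mul_lt_one hI hmem hρ hS' hy hξy
  have hξ : 0 < ξ := pos_of_mul_pos_left (one_pos.trans_le hξy) hy
  have hzero : gpdSurvival (-ξ) y = 0 := gpdSurvival_eq_zero hy (by linarith)
  have hend : gpdSurvival (-ξ) ξ⁻¹ = 0 := gpdSurvival_eq_zero (by positivity) (by simp [hξ.ne'])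
  rw [hzero]
  refine tendsto_order.2 ⟨fun b hb => Eventually.of_forall fun t =>
    hb.trans_le (div_nonneg (hS'0 _) (hS'0 _)), fun b hb => ?_⟩
  -- Just below the end `ξ⁻¹` of its support the limit is already below `b`.
  obtain ⟨z, ⟨hz0, hzξ⟩, hzb⟩ : ∃ z ∈ Ioo 0 ξ⁻¹, gpdSurvival (-ξ) z < b :=
    Eventually.exists <| (eventually_mem_set.2 (Ioo_mem_nhdsLT (inv_pos.2 hξ))).and
      (((continuous_gpdSurvival (-ξ)).tendsto ξ⁻¹).eventually_lt_const (hend.trans_lt hb)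
        |>.filter_mono nhdsWithin_le_nhds)
  have hξz : ξ * z < 1 := by rwa [← lt_inv_mul_iff₀ hξ, mul_one]
  have hzy : z ≤ y := hzξ.le.trans ((inv_le_iff_one_le_mul₀' hξ).2 hξy)
  filter_upwards [(h.tendsto_reciprocal_of_mul_lt_one hI hmem hρ hS' hz0.le
    hξz).eventually_lt_const hzb] with t ht
  refine (div_le_div_of_nonneg_right (hanti ?_) (hS'0 _)).trans_lt ht
  gcongr
  exact (reciprocalScale_pos h.scale_pos a _).le

theorem reciprocal (h : IsGPDTail S ξ ψ) (hI : I = Ioi a ∨ I = Iio a)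
    (hmem : ∀ᶠ t in tailFilter S, t ∈ I)
    (hρ : Tendsto (fun t => ψ t / (t - a)) (tailFilter S) (𝓝 ξ)) (hanti : Antitone S')
    (hS'0 : ∀ s, 0 ≤ S' s) (hS' : ∀ t ∈ I, S' (-1 / (t - a)) = S t)
    (htail : tailFilter S' ≤ map (fun t => -1 / (t - a)) (tailFilter S)) :
    IsGPDTail S' (-ξ) (reciprocalScale ψ a) :=
  of_tendsto hanti hS'0 (reciprocalScale_pos h.scale_pos a) fun _ hx =>
    (tendsto_map'_iff.2 (h.tendsto_reciprocal hI hmem hρ hanti hS'0 hS' hx)).mono_left htail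

end IsGPDTail
end Reciprocal

section Transform

variable {Ω : Type*} [MeasurableSpace Ω] {P : Measure Ω} {X : Ω → ℝ} {g : ℝ → ℝ} {I : Set ℝ}

theorem exists_gt_mem_of_survival_pos (hXI : ∀ᵐ ω ∂P, X ω ∈ I) {t : ℝ}
    (ht : 0 < survival P X t) : ∃ u ∈ I, t < u := by
  have hne : P {ω | t < X ω} ≠ 0 := fun h0 => ht.ne' (by simp [survival, measureReal_def, h0])
  obtain ⟨ω, htω, hω⟩ := ((frequently_ae_iff.2 hne).and_eventually hXI).exists
  exact ⟨X ω, hω, htω⟩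

theorem survival_comp_apply (hXI : ∀ᵐ ω ∂P, X ω ∈ I) (hg : StrictMonoOn g I) {t : ℝ}
    (ht : t ∈ I) : survival P (fun ω => g (X ω)) (g t) = survival P X t :=
  measureReal_congr (hXI.mono fun _ hω => propext (hg.lt_iff_lt ht hω))

variable [IsProbabilityMeasure P]

theorem tailFilter_survival_comp_le (hX : Measurable X) (hXI : ∀ᵐ ω ∂P, X ω ∈ I)
    (hI : I.OrdConnected) (hg : StrictMonoOn g I) (hgc : ContinuousOn g I)
    (hmem : ∀ᶠ t in tailFilter (survival P X), t ∈ I) :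
    tailFilter (survival P fun ω => g (X ω)) ≤ map g (tailFilter (survival P X)) := by
  obtain ⟨t₀, ht₀⟩ := exists_survival_pos (P := P) hX
  have := neBot_tailFilter ht₀
  have hbasis := hasBasis_tailFilter ht₀
  refine (hbasis.map g).ge_iff.2 fun T hT => ?_
  obtain ⟨T', ⟨hTT', hT'⟩, hT'I⟩ : ∃ t, (T ≤ t ∧ 0 < survival P X t) ∧ t ∈ I :=
    ((hbasis.eventually_iff.2 ⟨T, hT, fun _ h => h⟩).and hmem).exists
  have hgT' : 0 < survival P (fun ω => g (X ω)) (g T') := by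
    rwa [survival_comp_apply hXI hg hT'I]
  filter_upwards [eventually_ge_tailFilter hgT', eventually_pos_tailFilter _] with s hs hSs
  obtain ⟨_, ⟨u, hu, rfl⟩, hsu⟩ := exists_gt_mem_of_survival_pos
    (hXI.mono fun ω hω => mem_image_of_mem g hω) hSs
  have hle : T' ≤ u := (hg.le_iff_le hT'I hu).1 (hs.trans hsu.le)
  obtain ⟨t, ht, rfl⟩ := (hgc.mono (hI.out hT'I hu)).surjOn_Icc
    (left_mem_Icc.2 hle) (right_mem_Icc.2 hle) ⟨hs, hsu.le⟩
  have htI : t ∈ I := hI.out hT'I hu ht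
  exact ⟨t, ⟨hTT'.trans ht.1, by rwa [← survival_comp_apply hXI hg htI]⟩, rfl⟩

end Transform

section ResidualLimit

variable {Ω : Type*} [MeasurableSpace Ω] {P : Measure Ω} [IsProbabilityMeasure P] {X : Ω → ℝ}
  {ψ : ℝ → ℝ} {ξ a : ℝ} {I : Set ℝ}

theorem residualLimitGPD_neg_one_div_sub (hX : Measurable X) (hI : I = Ioi a ∨ I = Iio a)
    (hXI : ∀ᵐ ω ∂P, X ω ∈ I) (hmem : ∀ᶠ t in tailFilter (survival P X), t ∈ I)
    (h : IsGPDTail (survival P X) ξ ψ)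
    (hρ : Tendsto (fun t => ψ t / (t - a)) (tailFilter (survival P X)) (𝓝 ξ)) :
    ResidualLimitGPD P (fun ω => -1 / (X ω - a)) (-ξ) := by
  have hg := strictMonoOn_neg_one_div_sub hI
  have hord : I.OrdConnected := by
    rcases hI with rfl | rfl
    exacts [ordConnected_Ioi, ordConnected_Iio]
  have hcont : ContinuousOn (fun x => -1 / (x - a)) I :=
    continuousOn_const.div (continuousOn_id.sub continuousOn_const)
      fun x hx => sub_ne_zero.2 (ne_of_mem_Ioi_or_Iio hI hx)
  exact (residualLimitGPD_iff ((hX.sub_const a).const_div (-1)) (-ξ)).2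
    ⟨_, h.reciprocal hI hmem hρ antitone_survival survival_nonneg
      (fun t ht => survival_comp_apply hXI hg ht)
      (tailFilter_survival_comp_le hX hXI hord hg hcont hmem)⟩

theorem forall_survival_pos_or_exists_rightEndpoint_eq (hX : Measurable X) :
    (∀ t, 0 < survival P X t) ∨
      ∃ b : ℝ, rightEndpoint P X = b ∧ ∀ t, 0 < survival P X t ↔ t < b := by
  have hiff := lt_rightEndpoint_iff (P := P) hX
  obtain ⟨t₀, ht₀⟩ := exists_survival_pos (P := P) hX
  rcases eq_or_ne (rightEndpoint P X) ⊤ with htop | htop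
  · exact Or.inl fun t => (hiff t).1 (htop ▸ EReal.coe_lt_top t)
  · have hcoe := EReal.coe_toReal htop (((hiff t₀).2 ht₀).ne_bot)
    exact Or.inr ⟨_, hcoe.symm, fun t => by rw [← hiff, ← EReal.coe_lt_coe_iff (x := t), hcoe]⟩

theorem exists_gt_survival_pos_of_ae_gt (hX : Measurable X) (hXa : ∀ᵐ ω ∂P, a < X ω) :
    ∃ t, a < t ∧ 0 < survival P X t := by
  refine exists_gt_survival_pos hX ?_
  have hone := (mem_ae_iff_prob_eq_one (measurableSet_lt measurable_const hX)).1 hXa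
  simp [survival, measureReal_def, hone]

theorem tendsto_scale_div_sub_of_ae_gt (hX : Measurable X) (hξ : 0 ≤ ξ)
    (hXa : ∀ᵐ ω ∂P, a < X ω) (h : IsGPDTail (survival P X) ξ ψ) :
    Tendsto (fun t => ψ t / (t - a)) (tailFilter (survival P X)) (𝓝 ξ) := by
  obtain hpos | ⟨b, -, hb⟩ := forall_survival_pos_or_exists_rightEndpoint_eq (P := P) hX
  · exact h.tendsto_scale_div_sub_of_forall_pos antitone_survival hpos a
  obtain ⟨t₀, hat₀, ht₀⟩ := exists_gt_survival_pos_of_ae_gt hX hXa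
  have := neBot_tailFilter ht₀
  have hρ := h.tendsto_scale_div_sub_of_forall_pos_iff_lt antitone_survival hb
  have hξ0 : ξ = 0 := by
    refine hξ.antisymm' (le_of_tendsto hρ ((eventually_pos_tailFilter _).mono fun t ht => ?_))
    exact div_nonpos_of_nonneg_of_nonpos (h.scale_pos t).le (sub_nonpos.2 ((hb t).1 ht).le)
  have hba : b - a ≠ 0 := (sub_pos.2 (hat₀.trans ((hb t₀).1 ht₀))).ne'
  have hid : Tendsto (fun t => t - a) (tailFilter (survival P X)) (𝓝 (b - a)) := by
    rw [tailFilter_eq_nhdsLT hb]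
    exact (tendsto_nhdsWithin_of_tendsto_nhds tendsto_id).sub_const a
  rw [hξ0, ← zero_div (b - a)]
  exact (h.tendsto_scale_nhds_zero hb).div hid hba

theorem residualLimitGPD_neg_one_div_sub_of_ae_gt (hX : Measurable X) (hξ : 0 ≤ ξ)
    (hXa : ∀ᵐ ω ∂P, a < X ω) (h : ResidualLimitGPD P X ξ) :
    ResidualLimitGPD P (fun ω => -1 / (X ω - a)) (-ξ) := by
  obtain ⟨ψ, hψ⟩ := (residualLimitGPD_iff hX ξ).1 h
  obtain ⟨t₀, hat₀, ht₀⟩ := exists_gt_survival_pos_of_ae_gt hX hXa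
  exact residualLimitGPD_neg_one_div_sub hX (Or.inl rfl) hXa
    ((eventually_ge_tailFilter ht₀).mono fun t ht => hat₀.trans_le ht) hψ
    (tendsto_scale_div_sub_of_ae_gt hX hξ hXa hψ)

theorem exists_rightEndpoint_eq_of_neg (hX : Measurable X) (hξ : ξ < 0)
    (h : IsGPDTail (survival P X) ξ ψ) :
    ∃ b : ℝ, rightEndpoint P X = b ∧ ∀ t, 0 < survival P X t ↔ t < b := by
  refine (forall_survival_pos_or_exists_rightEndpoint_eq hX).resolve_left fun hpos => hξ.not_ge ?_
  have := neBot_tailFilter (hpos 0)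
  refine ge_of_tendsto (h.tendsto_scale_div_sub_of_forall_pos antitone_survival hpos 0)
    ((eventually_ge_tailFilter (hpos 0)).mono fun t ht => ?_)
  exact div_nonneg (h.scale_pos t).le (sub_nonneg.2 ht)

theorem ae_lt_of_survival_pos_iff_lt (h : IsGPDTail (survival P X) ξ ψ)
    (ha : ∀ t, 0 < survival P X t ↔ t < a) : ∀ᵐ ω ∂P, X ω < a := by
  have : (tailFilter (survival P X)).NeBot := by
    rw [tailFilter_eq_nhdsLT ha]
    infer_instance
  have hle : P.real {ω | a ≤ X ω} ≤ 0 :=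
    ge_of_tendsto (h.tendsto_zero antitone_survival survival_nonneg)
      ((eventually_pos_tailFilter _).mono fun t ht =>
        measureReal_mono fun _ hω => ((ha t).1 ht).trans_le hω)
  have hzero : P {ω | a ≤ X ω} = 0 :=
    (measureReal_eq_zero_iff (measure_ne_top P _)).1 (hle.antisymm measureReal_nonneg)
  simpa [ae_iff] using hzero

theorem residualLimitGPD_neg_one_div_sub_rightEndpoint (hX : Measurable X) (hξ : ξ < 0)
    (h : ResidualLimitGPD P X ξ) :
    ∃ b : ℝ, rightEndpoint P X = b ∧ ResidualLimitGPD P (fun ω => -1 / (X ω - b)) (-ξ) := by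
  obtain ⟨ψ, hψ⟩ := (residualLimitGPD_iff hX ξ).1 h
  obtain ⟨b, hend, hb⟩ := exists_rightEndpoint_eq_of_neg hX hξ hψ
  exact ⟨b, hend, residualLimitGPD_neg_one_div_sub hX (Or.inr rfl)
    (ae_lt_of_survival_pos_iff_lt hψ hb)
    ((eventually_pos_tailFilter _).mono fun t ht => (hb t).1 ht) hψ
    (hψ.tendsto_scale_div_sub_of_forall_pos_iff_lt antitone_survival hb)⟩

end ResidualLimit

theorem corollary2 {Ω : Type*} [MeasurableSpace Ω] (P : Measure Ω) [IsProbabilityMeasure P]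
    (X : Ω → ℝ) (hX : Measurable X) (ξ : ℝ) (h : ResidualLimitGPD P X ξ) :
    (0 ≤ ξ → (∀ᵐ ω ∂P, 0 < X ω) → ResidualLimitGPD P (fun ω => -1 / X ω) (-ξ)) ∧
    (ξ < 0 → ∃ a : ℝ, rightEndpoint P X = (a : EReal) ∧
      ResidualLimitGPD P (fun ω => -1 / (X ω - a)) (-ξ)) := by
  refine ⟨fun hξ hX0 => ?_, fun hξ => residualLimitGPD_neg_one_div_sub_rightEndpoint hX hξ h⟩
  simpa only [sub_zero] using residualLimitGPD_neg_one_div_sub_of_ae_gt hX hξ hX0 h
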